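/- Let $\mathcal H$ be a finite-dimensional physical Hilbert space (e.g. $n$ qubits), let $\mathcal N(\rho)=\sum_a E_a\rho E_a^\dagger$ be a noise channel on $\mathcal H$ given by a finite family of Kraus operators, $\sum_a E_a^\dagger E_a=1$, and let $\psi_1,\dots,\psi_K\in\mathcal H$ ($K\ge 1$) be orthonormal code words, with encoding map $\mathcal E(\rho)=V\rho V^\dagger$, $V=\sum_i|\psi_i\rangle\langle i|$. For a set $S$ of Kraus indices define the loss function, i.e. the total $L^1$ violation of the Knill–Laflamme conditions, $$\mathcal L_S=\sum_{a,b\in S}\Big[\sum_{i<j}|\langle\psi_i|E_a^\dagger E_b|\psi_j\rangle|+\sum_{i}\tfrac12\Big|\langle\psi_i|E_a^\dagger E_b|\psi_i\rangle-\tfrac1K\sum_{l}\langle\psi_l|E_a^\dagger E_b|\psi_l\rangle\Big|\Big],$$ and let $\mathcal L$ be the loss for the set of all Kraus indices. With the Uhlmann fidelity $f(\rho,\sigma)=\operatorname{Tr}\sqrt{\sqrt\rho\,\sigma\sqrt\rho}$, define the completely bounded fidelity and the worst-case fidelity $$\mathcal F_c=\sup_{\mathcal R}\inf_{\rho}f\big((\mathcal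 R\circ\mathcal N\circ\mathcal E\otimes\mathrm{id})(\rho),\rho\big),\qquad \mathcal F=\sup_{\mathcal R}\inf_{\rho}f\big((\mathcal R\circ\mathcal N\circ\mathcal E)(\rho),\rho\big),$$ where $\mathcal R$ runs over the channels (completely positive trace-preserving maps) from $\mathcal H$ to the $K$-dimensional logical space, and $\rho$ runs over the states of the logical space together with a reference system of arbitrary finite dimension (for $\mathcal F_c$), respectively over the states of the logical space (for $\mathcal F$). (1) One has $\varepsilon:=\sqrt{1-\mathcal F_c}\le K\sqrt{2\mathcal L}$, hence $\mathcal F_c\ge 1-2K^2\mathcal L$; moreover $\mathcal F_c\le\mathcal F\le 1$. (2) Let the Kraus operators $E_a=E_a(\gamma)$ and the orthonormal code words $\psi_i=\psi_i(\gamma)$ depend on a noise strength $\gamma>0$ (with fixed $\mathcal H$, $K$ and index set of the $E_a$), and let $t\ge 0$ be an integer. If $\mathcal L=O(\gamma^{t+1})$ as $\gamma\to0^+$, then $1-\mathcal F_c=O(\gamma^{t+1})$ and $1-\mathcal F=O(\gamma^{t+1})$. (3) The conclusion of (2) also holds if only $\mathcal L_S=O(\gamma^{t+1})$ for a fixed set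 $S$ of Kraus indices (for instance, the errors with at most $t$ jumps) such that the omitted errors satisfy $\sum_{a\notin S}\sum_i\|E_a\psi_i\|^2=O(\gamma^{t+1})$. -/

import Mathlib

open Filter Topology Asymptotics
open scoped ComplexOrder MatrixOrder Matrix

noncomputable section

namespace AQEC

/-- Density matrices: positive semidefinite complex matrices of trace one. -/
def DensityMatrix (a : Type*) [Fintype a] : Type _ :=
  {ρ : Matrix a a ℂ // ρ.PosSemidef ∧ ρ.trace = 1}

/-- The Uhlmann fidelity `Tr √(√ρ σ √ρ)` (the square-root convention). -/
def fidelity {a : Type*} [Fintype a] [DecidableEq a] (ρ σ : Matrix a a ℂ) : ℝ :=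
  (CFC.sqrt (CFC.sqrt ρ * σ * CFC.sqrt ρ)).trace.re

/-- The amplification `Φ ⊗ id_r`: the map `Φ` applied to the `r`-indexed blocks of a matrix. -/
def amplify {a b : Type*} (r : Type*) (Φ : Matrix a a ℂ →ₗ[ℂ] Matrix b b ℂ)
    (M : Matrix (a × r) (a × r) ℂ) : Matrix (b × r) (b × r) ℂ :=
  Matrix.of fun p q => Φ (Matrix.of fun i j => M (i, p.2) (j, q.2)) p.1 q.1

/-- Quantum channels: completely positive trace-preserving linear maps. -/
structure Channel (a b : Type*) [Fintype a] [Fintype b] where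
  toMap : Matrix a a ℂ →ₗ[ℂ] Matrix b b ℂ
  completelyPositive : ∀ (m : ℕ) (M : Matrix (a × Fin m) (a × Fin m) ℂ),
    M.PosSemidef → (amplify (Fin m) toMap M).PosSemidef
  tracePreserving : ∀ M : Matrix a a ℂ, (toMap M).trace = M.trace

/-- The linear map `ρ ↦ A ρ A†`. -/
def conjMap {a b : Type*} [Fintype a] (A : Matrix b a ℂ) :
    Matrix a a ℂ →ₗ[ℂ] Matrix b b ℂ where
  toFun ρ := A * ρ * Aᴴ
  map_add' ρ σ := by rw [Matrix.mul_add, Matrix.add_mul]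
  map_smul' c ρ := by simp

/-- The map `ρ ↦ ∑ₐ Eₐ ρ Eₐ†` with Kraus operators `Eₐ`. -/
def krausMap {d ι : Type*} [Fintype d] [Fintype ι] (E : ι → Matrix d d ℂ) :
    Matrix d d ℂ →ₗ[ℂ] Matrix d d ℂ :=
  ∑ a, conjMap (E a)

/-- The completeness relation `∑ₐ Eₐ† Eₐ = 1`, i.e. `krausMap E` is a channel. -/
def IsKrausFamily {d ι : Type*} [Fintype d] [DecidableEq d] [Fintype ι]
    (E : ι → Matrix d d ℂ) : Prop :=
  ∑ a, (E a)ᴴ * E a = 1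

/-- The encoding map `ρ ↦ V ρ V†`, where `V = ∑ᵢ |ψᵢ⟩⟨i|` sends the `i`-th logical basis state to
the code word `ψᵢ`. -/
def encode {d : Type*} {K : ℕ} (ψ : Fin K → EuclideanSpace ℂ d) :
    Matrix (Fin K) (Fin K) ℂ →ₗ[ℂ] Matrix d d ℂ :=
  conjMap (Matrix.of fun x i => ψ i x)

section Fidelities

variable {d : Type*} [Fintype d] {K : ℕ}
  (Enc : Matrix (Fin K) (Fin K) ℂ →ₗ[ℂ] Matrix d d ℂ) (N : Matrix d d ℂ →ₗ[ℂ] Matrix d d ℂ)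

/-- The completely bounded fidelity: best over recovery channels `R`, worst over the states `ρ` of
the logical system together with a reference system of arbitrary finite dimension `m`, of the
fidelity of `((R ∘ N ∘ Enc) ⊗ id)(ρ)` with `ρ`. -/
def cbFidelity : ℝ :=
  ⨆ R : Channel d (Fin K), ⨅ p : Σ m : ℕ, DensityMatrix (Fin K × Fin m),
    fidelity (amplify (Fin p.1) (R.toMap ∘ₗ N ∘ₗ Enc) p.2.1) p.2.1

/-- The worst-case fidelity: best over recovery channels `R`, worst over logical states `ρ`, of the
fidelity of `(R ∘ N ∘ Enc)(ρ)` with `ρ`. -/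
def worstCaseFidelity : ℝ :=
  ⨆ R : Channel d (Fin K), ⨅ ρ : DensityMatrix (Fin K),
    fidelity ((R.toMap ∘ₗ N ∘ₗ Enc) ρ.1) ρ.1

end Fidelities

section Loss

variable {d ι : Type*} [Fintype d] {K : ℕ}

/-- The matrix element `⟨φ|M|χ⟩`. -/
def braket (φ : EuclideanSpace ℂ d) (M : Matrix d d ℂ) (χ : EuclideanSpace ℂ d) : ℂ :=
  star φ.ofLp ⬝ᵥ (M *ᵥ χ.ofLp)

/-- The average `(1/K) ∑ᵢ ⟨ψᵢ|M|ψᵢ⟩` over the code words. -/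
def codeAverage (ψ : Fin K → EuclideanSpace ℂ d) (M : Matrix d d ℂ) : ℂ :=
  (∑ i, braket (ψ i) M (ψ i)) / K

/-- The `L¹` size of the Knill-Laflamme violation for one operator `M`: all off-diagonal elements
above the diagonal, and half of the deviations of the diagonal elements from their average. -/
def klViolation (ψ : Fin K → EuclideanSpace ℂ d) (M : Matrix d d ℂ) : ℝ :=
  (∑ i, ∑ j ∈ Finset.Ioi i, ‖braket (ψ i) M (ψ j)‖) +
    ∑ i, (1 / 2 : ℝ) * ‖braket (ψ i) M (ψ i) - codeAverage ψ M‖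

/-- The loss function of the code words `ψ` for the errors `Eₐ`, `a ∈ S`: the sum of the
Knill-Laflamme violations of all products `Eₐ† E_b` with `a, b ∈ S`. -/
def loss (ψ : Fin K → EuclideanSpace ℂ d) (E : ι → Matrix d d ℂ) (S : Finset ι) : ℝ :=
  ∑ a ∈ S, ∑ b ∈ S, klViolation ψ ((E a)ᴴ * E b)

/-- The total weight `∑ᵢ ∑_{a ∉ S} ‖Eₐ ψᵢ‖²` with which errors outside `S` act on the code words. -/
def omittedWeight [Fintype ι] [DecidableEq ι] (ψ : Fin K → EuclideanSpace ℂ d)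
    (E : ι → Matrix d d ℂ) (S : Finset ι) : ℝ :=
  ∑ i, ∑ a ∈ Sᶜ, (braket (ψ i) ((E a)ᴴ * E a) (ψ i)).re

end Loss

end AQEC

end

/-!
For the faulty code words `Eₐ ψᵢ`, `a ∈ S`, let `M` be the Gram matrix, indexed by pairs `(a, i)`.
The Knill–Laflamme conditions say that `M = λ ⊗ 1` for a matrix `λ` indexed by the errors, and for
the code average `λ` of `M` the loss is half of the entrywise `L¹` distance between `M` and `λ ⊗ 1`
(`sum_norm_gram_sub`). By the Powers–Størmer inequality (`sum_norm_sq_sub_le`) the loss bounds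
`‖√M - √λ ⊗ 1‖²` (Hilbert–Schmidt norm), so that `Re Tr ((√λ ⊗ 1) √M) ≥ K - w - L`, where `L` is the
loss and `w` the weight of the errors outside `S`.

The recovery comes from the polar decomposition of the matrix `W` with columns `Eₐ ψᵢ`: a
contraction `C` with `C W = √M`, followed by discarding the error index, and completed to a channel
(`exists_contraction_mul_eq`, `exists_kraus_of_contraction`). The blocks of `√M` are then Kraus
operators `Aₖ` of noise and recovery together, and the entries `sₖ` of `√λ` are scalars with
`∑ₖ |sₖ|² ≤ 1`.

It remains to pass from this averaged statement to the worst entangled input without losing a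
square root (`le_fidelity_amplify`). Put `B = ∑ₖ s̄ₖ Aₖ`. Cauchy–Schwarz gives
`B ρ Bᴴ ≤ ∑ₖ Aₖ ρ Aₖᴴ`, hence the fidelity is at least `Re Tr (ρ B)`, for mixed states as well
(`re_trace_mul_le_fidelity`). Completing the square, `G = 1 - (B + Bᴴ) / 2` is positive
semidefinite, so `Tr (ρ (G ⊗ 1)) ≤ Tr G` for every state `ρ`, and
`Tr G = K - Re ∑ₖ s̄ₖ Tr Aₖ ≤ L + w`. Thus `1 - F ≤ L + w` for the completely bounded fidelity
(`one_sub_le_cbFidelity`), from which all bounds and scalings follow.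
-/

noncomputable section

namespace AQEC

/-! ### Positive semidefinite matrices -/

section PosSemidef

variable {n : Type*} [Fintype n] [DecidableEq n]

theorem exists_unitary_diagonal {A : Matrix n n ℂ} (hA : A.IsHermitian) :
    ∃ (U : Matrix n n ℂ) (x : n → ℝ), Uᴴ * U = 1 ∧ U * Uᴴ = 1 ∧
      A = U * Matrix.diagonal (fun i => (x i : ℂ)) * Uᴴ := by
  refine ⟨hA.eigenvectorUnitary, hA.eigenvalues, ?_, ?_, ?_⟩
  · exact Unitary.coe_star_mul_self _
  · exact Unitary.coe_mul_star_self _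
  · conv_lhs => rw [hA.spectral_theorem]
    rw [Unitary.conjStarAlgAut_apply]
    rfl

theorem conj_mul_of_unitary {U : Matrix n n ℂ} (hU : U * Uᴴ = 1) (A B : Matrix n n ℂ) :
    Uᴴ * (A * B) * U = Uᴴ * A * U * (Uᴴ * B * U) := by
  have : Uᴴ * A * U * (Uᴴ * B * U) = Uᴴ * A * (U * Uᴴ) * B * U := by
    simp only [Matrix.mul_assoc]
  rw [this, hU, Matrix.mul_one]
  simp only [Matrix.mul_assoc]

theorem conj_diagonal_of_unitary {U : Matrix n n ℂ} (hU : Uᴴ * U = 1) (x : n → ℂ) :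
    Uᴴ * (U * Matrix.diagonal x * Uᴴ) * U = Matrix.diagonal x := by
  simp only [Matrix.mul_assoc, hU, Matrix.mul_one]
  rw [← Matrix.mul_assoc, hU, Matrix.one_mul]

theorem mul_conjTranspose_apply_self {m n : Type*} [Fintype n] (Y : Matrix m n ℂ) (i : m) :
    (Y * Yᴴ) i i = ((∑ j, ‖Y i j‖ ^ 2 : ℝ) : ℂ) := by
  rw [Matrix.mul_apply]
  push_cast
  refine Finset.sum_congr rfl fun j _ => ?_
  rw [Matrix.conjTranspose_apply, ← Complex.mul_conj']
  rfl

theorem trace_mul_conjTranspose {m n : Type*} [Fintype m] [Fintype n] (Y : Matrix m n ℂ) :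
    (Y * Yᴴ).trace = ((∑ i, ∑ j, ‖Y i j‖ ^ 2 : ℝ) : ℂ) := by
  simp only [Matrix.trace, Matrix.diag_apply, mul_conjTranspose_apply_self]
  push_cast
  rfl

/-- A variant of operator monotonicity of the square root: if `X Xᴴ ≤ Q²` with `Q` positive
semidefinite, then the real part of the trace of `X` is at most the trace of `Q`. -/
theorem re_trace_le_of_mul_conjTranspose_le {Q X : Matrix n n ℂ} (hQ : Q.PosSemidef)
    (h : (Q * Q - X * Xᴴ).PosSemidef) : X.trace.re ≤ Q.trace.re := by
  obtain ⟨U, q, hU, hU', hQU⟩ := exists_unitary_diagonal hQ.1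
  have hD : Uᴴ * Q * U = Matrix.diagonal (fun i => (q i : ℂ)) := by
    rw [hQU, conj_diagonal_of_unitary hU]
  have htr : ∀ Z : Matrix n n ℂ, Z.trace = (Uᴴ * Z * U).trace := fun Z => by
    rw [Matrix.trace_mul_cycle, hU', Matrix.one_mul]
  -- In an eigenbasis of `Q`, the `i`-th row of `X` has norm at most the eigenvalue `q i`.
  rw [htr X, htr Q, hD]
  simp only [Matrix.trace, Matrix.diag_apply, Matrix.diagonal_apply_eq, Complex.re_sum,
    Complex.ofReal_re]
  refine Finset.sum_le_sum fun i _ => ?_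
  have hq : 0 ≤ q i := by
    have := (hQ.conjTranspose_mul_mul_same U).diag_nonneg (i := i)
    rw [hD, Matrix.diagonal_apply_eq] at this
    exact_mod_cast this
  set Y := Uᴴ * X * U with hY
  have hYY : Uᴴ * (Q * Q - X * Xᴴ) * U =
      Matrix.diagonal (fun i => (q i : ℂ)) * Matrix.diagonal (fun i => (q i : ℂ)) - Y * Yᴴ := by
    rw [Matrix.mul_sub, Matrix.sub_mul, conj_mul_of_unitary hU', conj_mul_of_unitary hU', hD, hY]
    simp only [Matrix.conjTranspose_mul, Matrix.conjTranspose_conjTranspose, Matrix.mul_assoc]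
  have h2 := (h.conjTranspose_mul_mul_same U).diag_nonneg (i := i)
  rw [hYY, Matrix.diagonal_mul_diagonal, Matrix.sub_apply, Matrix.diagonal_apply_eq,
    mul_conjTranspose_apply_self, ← Complex.ofReal_mul, ← Complex.ofReal_sub] at h2
  have h4 : 0 ≤ q i * q i - ∑ j, ‖Y i j‖ ^ 2 := by exact_mod_cast h2
  have h5 : ‖Y i i‖ ^ 2 ≤ ∑ j, ‖Y i j‖ ^ 2 :=
    Finset.single_le_sum (f := fun j => ‖Y i j‖ ^ 2) (fun j _ => by positivity)
      (Finset.mem_univ i)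
  calc (Y i i).re ≤ ‖Y i i‖ := Complex.re_le_norm _
    _ ≤ q i := abs_le_of_sq_le_sq' (by nlinarith) hq |>.2

/-- **Powers–Størmer inequality**, with the trace norm on the right-hand side replaced by the
larger entrywise `L¹` norm. -/
theorem sum_norm_sq_sub_le {P Q : Matrix n n ℂ} (hP : P.PosSemidef) (hQ : Q.PosSemidef) :
    ∑ i, ∑ j, ‖(P - Q) i j‖ ^ 2 ≤ ∑ i, ∑ j, ‖(P * P - Q * Q) i j‖ := by
  obtain ⟨U, x, hU, hU', hD⟩ := exists_unitary_diagonal (hP.1.sub hQ.1)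
  have hfrob : ∑ i, ∑ j, ‖(P - Q) i j‖ ^ 2 = ∑ i, x i ^ 2 := by
    have h1 := trace_mul_conjTranspose (P - Q)
    have h2 : ((P - Q) * (P - Q)ᴴ).trace = ((∑ i, x i ^ 2 : ℝ) : ℂ) := by
      rw [(hP.1.sub hQ.1).eq, hD]
      have : U * Matrix.diagonal (fun i => (x i : ℂ)) * Uᴴ *
          (U * Matrix.diagonal (fun i => (x i : ℂ)) * Uᴴ) =
          U * Matrix.diagonal (fun i => (x i : ℂ)) * (Uᴴ * U) *
          Matrix.diagonal (fun i => (x i : ℂ)) * Uᴴ := by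
        simp only [Matrix.mul_assoc]
      rw [this, hU, Matrix.mul_one, Matrix.mul_assoc U, Matrix.trace_mul_cycle, hU, Matrix.one_mul,
        Matrix.diagonal_mul_diagonal, Matrix.trace_diagonal]
      push_cast
      exact Finset.sum_congr rfl fun i _ => by ring
    exact_mod_cast h1.symm.trans h2
  set Δ := P * P - Q * Q with hΔ
  have hrow : ∀ k, ∑ i, ‖U k i‖ ^ 2 = 1 := fun k => by
    have h1 := congrFun (congrFun hU' k) k
    rw [mul_conjTranspose_apply_self, Matrix.one_apply_eq] at h1
    exact_mod_cast h1
  -- In the eigenbasis of `P - Q`, each squared eigenvalue is dominated by a diagonal entry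
  -- of `P ^ 2 - Q ^ 2`.
  have hdiag : ∀ i, x i ^ 2 ≤ ‖(Uᴴ * Δ * U) i i‖ := fun i => by
    set p := Uᴴ * P * U with hp
    set q := Uᴴ * Q * U with hq
    set D := Matrix.diagonal (fun i => (x i : ℂ)) with hDdef
    have hpq : p - q = D := by
      rw [hp, hq, ← Matrix.sub_mul, ← Matrix.mul_sub, hD, conj_diagonal_of_unitary hU]
    have h1 : Uᴴ * Δ * U = D * D + D * q + q * D := by
      rw [hΔ, Matrix.mul_sub, Matrix.sub_mul, conj_mul_of_unitary hU',
        conj_mul_of_unitary hU', ← hp, ← hq,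
        show p = D + q from by rw [← hpq]; abel]
      noncomm_ring
    have h2 : (Uᴴ * Δ * U) i i = (x i : ℂ) * (p i i + q i i) := by
      rw [h1, show p = D + q from by rw [← hpq]; abel]
      simp only [Matrix.add_apply, hDdef, Matrix.diagonal_mul, Matrix.mul_diagonal,
        Matrix.diagonal_apply_eq]
      ring
    have hp0 := (hP.conjTranspose_mul_mul_same U).diag_nonneg (i := i)
    have hq0 := (hQ.conjTranspose_mul_mul_same U).diag_nonneg (i := i)
    rw [← hp] at hp0
    rw [← hq] at hq0
    obtain ⟨a, ha0, ha⟩ := RCLike.nonneg_iff_exists_ofReal.mp hp0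
    obtain ⟨b, hb0, hb⟩ := RCLike.nonneg_iff_exists_ofReal.mp hq0
    replace ha : p i i = (a : ℂ) := ha.symm
    replace hb : q i i = (b : ℂ) := hb.symm
    have hab : x i = a - b := by
      have := congrFun (congrFun hpq i) i
      rw [Matrix.sub_apply, ha, hb, hDdef, Matrix.diagonal_apply_eq] at this
      exact_mod_cast this.symm
    rw [h2, ha, hb, ← Complex.ofReal_add, ← Complex.ofReal_mul, Complex.norm_real,
      Real.norm_eq_abs, abs_mul, abs_of_nonneg (add_nonneg ha0 hb0), ← sq_abs, sq]
    refine mul_le_mul_of_nonneg_left ?_ (abs_nonneg _)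
    rw [hab, abs_le]
    constructor <;> linarith
  rw [hfrob]
  calc ∑ i, x i ^ 2 ≤ ∑ i, ‖(Uᴴ * Δ * U) i i‖ := Finset.sum_le_sum fun i _ => hdiag i
    _ ≤ ∑ i, ∑ k, ∑ l, ‖Δ l k‖ * (‖U l i‖ * ‖U k i‖) := by
        refine Finset.sum_le_sum fun i _ => ?_
        rw [Matrix.mul_apply]
        refine (norm_sum_le _ _).trans (Finset.sum_le_sum fun k _ => ?_)
        rw [Matrix.mul_apply, norm_mul]
        refine (mul_le_mul_of_nonneg_right (norm_sum_le _ _) (norm_nonneg _)).trans_eq ?_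
        rw [Finset.sum_mul]
        refine Finset.sum_congr rfl fun l _ => ?_
        rw [norm_mul, Matrix.conjTranspose_apply, norm_star]
        ring
    _ = ∑ l, ∑ k, ‖Δ l k‖ * ∑ i, ‖U l i‖ * ‖U k i‖ := by
        rw [Finset.sum_comm]
        rw [Finset.sum_comm (s := Finset.univ (α := n)) (f := fun l k => ‖Δ l k‖ * _)]
        refine Finset.sum_congr rfl fun k _ => ?_
        rw [Finset.sum_comm]
        simp only [Finset.mul_sum]
    _ ≤ ∑ l, ∑ k, ‖Δ l k‖ := by
        refine Finset.sum_le_sum fun l _ => Finset.sum_le_sum fun k _ => ?_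
        refine mul_le_of_le_one_right (norm_nonneg _) ?_
        -- The rows of `U` are unit vectors.
        have h1 := Finset.sum_le_sum fun i (_ : i ∈ Finset.univ) =>
          two_mul_le_add_sq ‖U l i‖ ‖U k i‖
        rw [Finset.sum_add_distrib, hrow, hrow] at h1
        simp only [mul_assoc, ← Finset.mul_sum] at h1
        linarith

/-- A positive semidefinite matrix is at most its trace times the identity. -/
theorem posSemidef_trace_smul_one_sub {G : Matrix n n ℂ} (hG : G.PosSemidef) :
    (G.trace • (1 : Matrix n n ℂ) - G).PosSemidef := by
  obtain ⟨U, x, hU, hU', hD⟩ := exists_unitary_diagonal hG.1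
  have hDG : Uᴴ * G * U = Matrix.diagonal (fun i => (x i : ℂ)) := by
    rw [hD, conj_diagonal_of_unitary hU]
  have hx : ∀ i, 0 ≤ x i := fun i => by
    have := (hG.conjTranspose_mul_mul_same U).diag_nonneg (i := i)
    rw [hDG, Matrix.diagonal_apply_eq] at this
    exact_mod_cast this
  have htr : G.trace = ((∑ i, x i : ℝ) : ℂ) := by
    rw [hD, Matrix.trace_mul_cycle, hU, Matrix.one_mul, Matrix.trace_diagonal]
    push_cast
    rfl
  have : G.trace • (1 : Matrix n n ℂ) - G =
      U * Matrix.diagonal (fun i => ((∑ j, x j - x i : ℝ) : ℂ)) * Uᴴ := by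
    have h1 : Matrix.diagonal (fun i => ((∑ j, x j - x i : ℝ) : ℂ)) =
        G.trace • (1 : Matrix n n ℂ) - Matrix.diagonal (fun i => (x i : ℂ)) := by
      rw [htr, ← Matrix.diagonal_one, ← Matrix.diagonal_smul, Matrix.diagonal_sub]
      congr 1
      funext i
      simp
    rw [h1, Matrix.mul_sub, Matrix.sub_mul, ← hD]
    simp [hU']
  rw [this]
  refine (Matrix.PosSemidef.diagonal fun i => ?_).mul_mul_conjTranspose_same U
  have : 0 ≤ ∑ j, x j - x i :=
    sub_nonneg.mpr (Finset.single_le_sum (fun j _ => hx j) (Finset.mem_univ i))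
  simpa using Complex.zero_le_real.mpr this

theorem re_trace_mul_nonneg {A B : Matrix n n ℂ} (hA : A.PosSemidef) (hB : B.PosSemidef) :
    0 ≤ (A * B).trace.re := by
  have h := CFC.sqrt_mul_sqrt_self B hB.nonneg
  have hs : (CFC.sqrt B).PosSemidef := Matrix.nonneg_iff_posSemidef.mp (CFC.sqrt_nonneg B)
  have h2 := (hA.mul_mul_conjTranspose_same (CFC.sqrt B)).trace_nonneg
  rw [hs.1.eq, Matrix.trace_mul_cycle, h, Matrix.trace_mul_comm] at h2
  exact (Complex.nonneg_iff.mp h2).1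

/-- A Hermitian matrix has a Hermitian pseudo-inverse commuting with it. -/
theorem exists_pseudoInverse {P : Matrix n n ℂ} (hP : P.IsHermitian) :
    ∃ Q : Matrix n n ℂ, Q.IsHermitian ∧ Q * P = P * Q ∧ Q * P * P = P ∧ Q * Q * P = Q := by
  obtain ⟨U, x, hU, hU', hD⟩ := exists_unitary_diagonal hP
  have mulc : ∀ y z : n → ℂ, U * Matrix.diagonal y * Uᴴ * (U * Matrix.diagonal z * Uᴴ) =
      U * Matrix.diagonal (fun i => y i * z i) * Uᴴ := fun y z => by
    have : U * Matrix.diagonal y * Uᴴ * (U * Matrix.diagonal z * Uᴴ) =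
        U * Matrix.diagonal y * (Uᴴ * U) * Matrix.diagonal z * Uᴴ := by
      simp only [Matrix.mul_assoc]
    rw [this, hU, Matrix.mul_one, Matrix.mul_assoc U, Matrix.diagonal_mul_diagonal]
  -- Lean's convention `0⁻¹ = 0` makes this the pseudo-inverse on the kernel of `P`.
  refine ⟨U * Matrix.diagonal (fun i => ((x i)⁻¹ : ℂ)) * Uᴴ, ?_, ?_, ?_, ?_⟩
  · refine Matrix.isHermitian_mul_mul_conjTranspose _ ?_
    rw [Matrix.isHermitian_diagonal_iff]
    intro i
    simp [isSelfAdjoint_iff]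
  · rw [hD, mulc, mulc]
    simp only [mul_comm]
  · rw [hD, mulc, mulc]
    congr 3
    funext i
    by_cases h : (x i : ℂ) = 0 <;> simp [h]
  · rw [hD, mulc, mulc]
    congr 3
    funext i
    by_cases h : (x i : ℂ) = 0 <;> simp [h]

/-- A contraction `C` carrying `W` to the positive part `√(Wᴴ W)` of its polar decomposition. -/
theorem exists_contraction_mul_eq {m : Type*} [Fintype m] [DecidableEq m] (W : Matrix m n ℂ)
    {P : Matrix n n ℂ} (hP : P.IsHermitian) (hPW : P * P = Wᴴ * W) :
    ∃ C : Matrix n m ℂ, C * W = P ∧ (1 - Cᴴ * C).PosSemidef := by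
  obtain ⟨Q, hQ, hcomm, h1, h2⟩ := exists_pseudoInverse hP
  refine ⟨Q * Wᴴ, by rw [Matrix.mul_assoc, ← hPW, ← Matrix.mul_assoc, h1], ?_⟩
  set Z := (Q * Wᴴ)ᴴ * (Q * Wᴴ) with hZ
  have hZ' : Z = W * (Q * Q) * Wᴴ := by
    rw [hZ, Matrix.conjTranspose_mul, Matrix.conjTranspose_conjTranspose, hQ.eq]
    simp only [Matrix.mul_assoc]
  -- `Z` is the orthogonal projection onto the range of `W`.
  have hidem : Z * Z = Z := by
    have : Z * Z = W * (Q * Q * (Wᴴ * W) * Q * Q) * Wᴴ := by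
      rw [hZ']
      simp only [Matrix.mul_assoc]
    rw [this, ← hPW, ← Matrix.mul_assoc (Q * Q), h2, Matrix.mul_assoc Q P Q, ← hcomm,
      ← Matrix.mul_assoc Q Q P, h2, hZ']
  have hherm : Zᴴ = Z := by
    rw [hZ, Matrix.conjTranspose_mul, Matrix.conjTranspose_conjTranspose]
  have : 1 - Z = (1 - Z)ᴴ * (1 - Z) := by
    rw [Matrix.conjTranspose_sub, hherm, Matrix.conjTranspose_one, Matrix.mul_sub, Matrix.sub_mul,
      Matrix.sub_mul, hidem]
    simp
  rw [this]
  exact Matrix.posSemidef_conjTranspose_mul_self _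

end PosSemidef

/-! ### Channels in Kraus form -/

section Kraus

open scoped Kronecker

variable {a b κ : Type*} [Fintype a] [Fintype κ]

theorem sum_conjMap_apply (A : κ → Matrix b a ℂ) (M : Matrix a a ℂ) :
    (∑ k, conjMap (A k)) M = ∑ k, A k * M * (A k)ᴴ := by
  rw [LinearMap.sum_apply]
  rfl

theorem amplify_sum_conjMap {r : Type*} [Fintype r] [DecidableEq r] (A : κ → Matrix b a ℂ)
    (M : Matrix (a × r) (a × r) ℂ) :
    amplify r (∑ k, conjMap (A k)) M =
      ∑ k, (A k ⊗ₖ (1 : Matrix r r ℂ)) * M * (A k ⊗ₖ (1 : Matrix r r ℂ))ᴴ := by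
  ext ⟨p, u⟩ ⟨q, v⟩
  simp only [amplify, Matrix.of_apply, sum_conjMap_apply, Matrix.sum_apply]
  refine Finset.sum_congr rfl fun k _ => ?_
  simp [Matrix.mul_apply, Fintype.sum_prod_type, Matrix.one_apply, apply_ite (starRingEnd ℂ)]

theorem sub_kronecker {l m p q : Type*} (A A' : Matrix l m ℂ) (B : Matrix p q ℂ) :
    (A - A') ⊗ₖ B = A ⊗ₖ B - A' ⊗ₖ B := by
  ext
  exact sub_mul _ _ _

variable [Fintype b]

/-- The channel with Kraus operators `F k`. -/
def krausChannel [DecidableEq a] (F : κ → Matrix b a ℂ) (hF : ∑ k, (F k)ᴴ * F k = 1) :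
    Channel a b where
  toMap := ∑ k, conjMap (F k)
  completelyPositive m M hM := by
    rw [amplify_sum_conjMap]
    exact Matrix.posSemidef_sum _ fun k _ => hM.mul_mul_conjTranspose_same _
  tracePreserving M := by
    rw [sum_conjMap_apply, Matrix.trace_sum]
    have h : ∀ k, (F k * M * (F k)ᴴ).trace = ((F k)ᴴ * F k * M).trace := fun k =>
      Matrix.trace_mul_cycle _ _ _
    simp only [h]
    rw [← Matrix.trace_sum, ← Matrix.sum_mul, hF, Matrix.one_mul]

end Kraus

/-! ### Fidelity estimates -/

section Fidelity

open scoped Kronecker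

variable {n κ : Type*} [Fintype n] [DecidableEq n] [Fintype κ]

theorem fidelity_nonneg (ρ σ : Matrix n n ℂ) : 0 ≤ fidelity ρ σ :=
  (Complex.nonneg_iff.mp (Matrix.nonneg_iff_posSemidef.mp (CFC.sqrt_nonneg _)).trace_nonneg).1

theorem posSemidef_one_sub_mul_conjTranspose {C : Matrix n n ℂ} (hC : (1 - Cᴴ * C).PosSemidef) :
    (1 - C * Cᴴ).PosSemidef := by
  have : 1 - C * Cᴴ = (1 - C * Cᴴ)ᴴ * (1 - C * Cᴴ) + C * (1 - Cᴴ * C) * Cᴴ := by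
    rw [Matrix.conjTranspose_sub, Matrix.conjTranspose_mul, Matrix.conjTranspose_conjTranspose,
      Matrix.conjTranspose_one]
    noncomm_ring
  rw [this]
  exact (Matrix.posSemidef_conjTranspose_mul_self _).add (hC.mul_mul_conjTranspose_same C)

/-- One half of `Tr √(Yᴴ Y) = Tr √(Y Yᴴ)`; the other half is the same statement for `Yᴴ`. -/
theorem re_trace_sqrt_conjTranspose_mul_le (Y : Matrix n n ℂ) :
    (CFC.sqrt (Yᴴ * Y)).trace.re ≤ (CFC.sqrt (Y * Yᴴ)).trace.re := by
  have hP : (CFC.sqrt (Yᴴ * Y)).PosSemidef := Matrix.nonneg_iff_posSemidef.mp (CFC.sqrt_nonneg _)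
  obtain ⟨C, hC, hC1⟩ := exists_contraction_mul_eq Y hP.1
    (CFC.sqrt_mul_sqrt_self _ (Matrix.posSemidef_conjTranspose_mul_self Y).nonneg)
  rw [← hC, Matrix.trace_mul_comm]
  refine re_trace_le_of_mul_conjTranspose_le
    (Matrix.nonneg_iff_posSemidef.mp (CFC.sqrt_nonneg _)) ?_
  rw [CFC.sqrt_mul_sqrt_self _ (Matrix.posSemidef_self_mul_conjTranspose Y).nonneg]
  convert (posSemidef_one_sub_mul_conjTranspose hC1).mul_mul_conjTranspose_same Y using 1
  rw [Matrix.conjTranspose_mul]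
  noncomm_ring

theorem fidelity_le_fidelity_swap {ρ σ : Matrix n n ℂ} (hρ : ρ.PosSemidef) (hσ : σ.PosSemidef) :
    fidelity ρ σ ≤ fidelity σ ρ := by
  have hadj : (CFC.sqrt σ * CFC.sqrt ρ)ᴴ = CFC.sqrt ρ * CFC.sqrt σ := by
    rw [Matrix.conjTranspose_mul,
      (Matrix.nonneg_iff_posSemidef.mp (CFC.sqrt_nonneg ρ)).1.eq,
      (Matrix.nonneg_iff_posSemidef.mp (CFC.sqrt_nonneg σ)).1.eq]
  have h := re_trace_sqrt_conjTranspose_mul_le (CFC.sqrt σ * CFC.sqrt ρ)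
  have h1 : CFC.sqrt ρ * CFC.sqrt σ * (CFC.sqrt σ * CFC.sqrt ρ) =
      CFC.sqrt ρ * σ * CFC.sqrt ρ := by
    conv_rhs => rw [← CFC.sqrt_mul_sqrt_self σ hσ.nonneg]
    simp only [Matrix.mul_assoc]
  have h2 : CFC.sqrt σ * CFC.sqrt ρ * (CFC.sqrt ρ * CFC.sqrt σ) =
      CFC.sqrt σ * ρ * CFC.sqrt σ := by
    conv_rhs => rw [← CFC.sqrt_mul_sqrt_self ρ hρ.nonneg]
    simp only [Matrix.mul_assoc]
  rwa [hadj, h1, h2] at h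

theorem fidelity_comm {ρ σ : Matrix n n ℂ} (hρ : ρ.PosSemidef) (hσ : σ.PosSemidef) :
    fidelity ρ σ = fidelity σ ρ :=
  le_antisymm (fidelity_le_fidelity_swap hρ hσ) (fidelity_le_fidelity_swap hσ hρ)

/-- If `B σ Bᴴ ≤ ρ`, then the fidelity of `ρ` and `σ` is at least `Re Tr (σ B)`. -/
theorem re_trace_mul_le_fidelity {ρ σ B : Matrix n n ℂ} (hσ : σ.PosSemidef)
    (hρ : ρ.PosSemidef) (h : (ρ - B * σ * Bᴴ).PosSemidef) :
    (σ * B).trace.re ≤ fidelity ρ σ := by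
  rw [fidelity_comm hρ hσ]
  set s := CFC.sqrt σ with hs
  have hs2 : s * s = σ := CFC.sqrt_mul_sqrt_self σ hσ.nonneg
  have hsP : s.PosSemidef := Matrix.nonneg_iff_posSemidef.mp (CFC.sqrt_nonneg σ)
  have htr : (σ * B).trace = (s * B * s).trace := by
    rw [Matrix.trace_mul_comm (s * B), ← Matrix.mul_assoc, hs2]
  have hQ : (s * ρ * s).PosSemidef := by
    have := hρ.mul_mul_conjTranspose_same s
    rwa [hsP.1.eq] at this
  rw [htr, fidelity, ← hs]
  refine re_trace_le_of_mul_conjTranspose_le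
    (Matrix.nonneg_iff_posSemidef.mp (CFC.sqrt_nonneg _)) ?_
  rw [CFC.sqrt_mul_sqrt_self _ hQ.nonneg]
  have h2 := h.mul_mul_conjTranspose_same s
  convert h2 using 1
  simp only [Matrix.conjTranspose_mul, hsP.1.eq, Matrix.mul_sub, Matrix.sub_mul, ← hs2,
    Matrix.mul_assoc]

/-- The operator Cauchy–Schwarz inequality
`(∑ₖ s̄ₖ Aₖ) ρ (∑ₖ s̄ₖ Aₖ)ᴴ ≤ ∑ₖ Aₖ ρ Aₖᴴ` for a vector `s` of norm at most one. -/
theorem posSemidef_sum_conj_sub {l m : Type*} [Fintype l] [Fintype m] (A : κ → Matrix m l ℂ)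
    (s : κ → ℂ)
    (hs : ∑ k, ‖s k‖ ^ 2 ≤ 1) {ρ : Matrix l l ℂ} (hρ : ρ.PosSemidef) :
    (∑ k, A k * ρ * (A k)ᴴ -
      (∑ k, star (s k) • A k) * ρ * (∑ k, star (s k) • A k)ᴴ).PosSemidef := by
  set B := ∑ k, star (s k) • A k with hB
  set τ := ∑ k, ‖s k‖ ^ 2 with hτ
  -- Expand `∑ₖ (Aₖ - sₖ B) ρ (Aₖ - sₖ B)ᴴ`.
  have key : ∑ k, A k * ρ * (A k)ᴴ - B * ρ * Bᴴ =
      ∑ k, (A k - s k • B) * ρ * (A k - s k • B)ᴴ + ((1 - τ : ℝ) : ℂ) • (B * ρ * Bᴴ) := by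
    have h1 : ∀ k, (A k - s k • B) * ρ * (A k - s k • B)ᴴ =
        A k * ρ * (A k)ᴴ - (star (s k) • A k) * ρ * Bᴴ - B * ρ * (star (s k) • A k)ᴴ +
          ((‖s k‖ ^ 2 : ℝ) : ℂ) • (B * ρ * Bᴴ) := fun k => by
      have h2 : ((‖s k‖ ^ 2 : ℝ) : ℂ) = s k * star (s k) := by
        push_cast
        rw [← Complex.mul_conj']
        rfl
      rw [h2]
      simp only [Matrix.conjTranspose_sub, Matrix.conjTranspose_smul, Matrix.sub_mul,
        Matrix.mul_sub, Matrix.smul_mul, Matrix.mul_smul, star_star, smul_sub]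
      rw [smul_smul, mul_comm (star (s k))]
      abel
    simp_rw [h1]
    rw [Finset.sum_add_distrib, Finset.sum_sub_distrib, Finset.sum_sub_distrib, ← Finset.sum_smul,
      ← Matrix.sum_mul, ← Matrix.sum_mul, ← Matrix.mul_sum, ← Matrix.conjTranspose_sum, ← hB,
      ← Complex.ofReal_sum, ← hτ]
    push_cast
    rw [sub_smul, one_smul]
    abel
  rw [key]
  refine (Matrix.posSemidef_sum _ fun k _ => hρ.mul_mul_conjTranspose_same _).add
    ((hρ.mul_mul_conjTranspose_same B).smul ?_)
  exact_mod_cast sub_nonneg.mpr hs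

/-- For a channel with Kraus operators `Aₖ` on a `K`-dimensional system and a vector `s` of norm at
most one, the channel preserves every entangled state up to the infidelity
`K - Re ∑ₖ s̄ₖ Tr Aₖ`. The operator `G = 1 - Re ∑ₖ s̄ₖ Aₖ` is positive semidefinite with this number
as its trace, so its expectation in any state is at most its trace. -/
theorem le_fidelity_amplify (A : κ → Matrix n n ℂ) (hA : ∑ k, (A k)ᴴ * A k = 1) (s : κ → ℂ)
    (hs : ∑ k, ‖s k‖ ^ 2 ≤ 1) {r : Type*} [Fintype r] [DecidableEq r]
    {ρ : Matrix (n × r) (n × r) ℂ} (hρ : ρ.PosSemidef) (hρ1 : ρ.trace = 1) :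
    1 - (Fintype.card n - (∑ k, star (s k) * (A k).trace).re) ≤
      fidelity (amplify r (∑ k, conjMap (A k)) ρ) ρ := by
  set B := ∑ k, star (s k) • A k with hB
  set T : Matrix (n × r) (n × r) ℂ := B ⊗ₖ 1 with hT
  have hTsum : T = ∑ k, star (s k) • (A k ⊗ₖ (1 : Matrix r r ℂ)) := by
    rw [hT, hB]
    ext ⟨i, u⟩ ⟨j, v⟩
    simp [Matrix.sum_apply, Finset.sum_mul, mul_assoc]
  have hfid : (ρ * T).trace.re ≤ fidelity (amplify r (∑ k, conjMap (A k)) ρ) ρ := by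
    rw [amplify_sum_conjMap]
    refine re_trace_mul_le_fidelity hρ
      (Matrix.posSemidef_sum _ fun k _ => hρ.mul_mul_conjTranspose_same _) ?_
    rw [hTsum]
    exact posSemidef_sum_conj_sub _ s hs hρ
  set G : Matrix n n ℂ := 1 - (1 / 2 : ℂ) • (B + Bᴴ) with hG
  set τ := ∑ k, ‖s k‖ ^ 2 with hτ
  have hGpos : G.PosSemidef := by
    have h1 : ∀ k, (A k - s k • (1 : Matrix n n ℂ))ᴴ * (A k - s k • (1 : Matrix n n ℂ)) =
        (A k)ᴴ * A k - star (s k) • A k - (star (s k) • A k)ᴴ +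
          ((‖s k‖ ^ 2 : ℝ) : ℂ) • (1 : Matrix n n ℂ) := fun k => by
      have h2 : ((‖s k‖ ^ 2 : ℝ) : ℂ) = s k * star (s k) := by
        push_cast
        rw [← Complex.mul_conj']
        rfl
      rw [h2]
      simp only [Matrix.conjTranspose_sub, Matrix.conjTranspose_smul, Matrix.sub_mul,
        Matrix.mul_sub, Matrix.smul_mul, Matrix.mul_smul, star_star, smul_sub, Matrix.one_mul,
        Matrix.mul_one, Matrix.conjTranspose_one, smul_smul]
      abel
    -- Completing the square: `2 G = ∑ₖ (Aₖ - sₖ)ᴴ (Aₖ - sₖ) + (1 - ∑ₖ |sₖ|²)`.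
    have h3 : G = (1 / 2 : ℂ) • (∑ k, (A k - s k • (1 : Matrix n n ℂ))ᴴ *
        (A k - s k • (1 : Matrix n n ℂ)) + ((1 - τ : ℝ) : ℂ) • (1 : Matrix n n ℂ)) := by
      simp_rw [h1]
      rw [Finset.sum_add_distrib, Finset.sum_sub_distrib, Finset.sum_sub_distrib,
        ← Finset.sum_smul, ← Matrix.conjTranspose_sum, ← hB, ← Complex.ofReal_sum, ← hτ, hA, hG]
      push_cast
      module
    rw [h3]
    refine ((Matrix.posSemidef_sum _ fun k _ => Matrix.posSemidef_conjTranspose_mul_self _).add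
      (Matrix.PosSemidef.one.smul ?_)).smul ?_
    · exact_mod_cast sub_nonneg.mpr hs
    · simp
  have hGtr : G.trace.re = Fintype.card n - (∑ k, star (s k) * (A k).trace).re := by
    have : (∑ k, star (s k) * (A k).trace) = B.trace := by
      rw [hB, Matrix.trace_sum]
      simp
    rw [this, hG]
    simp [Matrix.trace_sub, Matrix.trace_add, Matrix.trace_smul, Matrix.trace_conjTranspose]
    ring
  have hGkron :
      (G.trace • (1 : Matrix (n × r) (n × r) ℂ) - G ⊗ₖ (1 : Matrix r r ℂ)).PosSemidef := by
    have := (posSemidef_trace_smul_one_sub hGpos).kronecker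
      (Matrix.PosSemidef.one (n := r) (R := ℂ))
    have h : (G.trace • (1 : Matrix n n ℂ) - G) ⊗ₖ (1 : Matrix r r ℂ) =
        G.trace • (1 : Matrix (n × r) (n × r) ℂ) - G ⊗ₖ (1 : Matrix r r ℂ) := by
      rw [sub_kronecker, Matrix.smul_kronecker, Matrix.one_kronecker_one]
    rwa [h] at this
  have h4 := re_trace_mul_nonneg hρ hGkron
  have h5 : G ⊗ₖ (1 : Matrix r r ℂ) = 1 - (1 / 2 : ℂ) • (T + Tᴴ) := by
    rw [hG, hT, sub_kronecker, Matrix.smul_kronecker, Matrix.add_kronecker,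
      Matrix.one_kronecker_one, Matrix.conjTranspose_kronecker, Matrix.conjTranspose_one]
  have h6 : (ρ * Tᴴ).trace = star (ρ * T).trace := by
    rw [← Matrix.trace_conjTranspose, Matrix.conjTranspose_mul, hρ.1.eq, Matrix.trace_mul_comm]
  clear_value G
  have h7 : (ρ * (G.trace • 1 - (1 - (1 / 2 : ℂ) • (T + Tᴴ)))).trace =
      G.trace - (1 - (1 / 2 : ℂ) * ((ρ * T).trace + star (ρ * T).trace)) := by
    rw [Matrix.mul_sub, Matrix.mul_sub, Matrix.mul_smul, Matrix.mul_smul, Matrix.mul_add,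
      Matrix.trace_sub, Matrix.trace_sub, Matrix.trace_smul, Matrix.trace_smul, Matrix.trace_add,
      h6, Matrix.mul_one, hρ1]
    simp
  have h8 : ((1 / 2 : ℂ) * ((ρ * T).trace + star (ρ * T).trace)).re = (ρ * T).trace.re := by
    simp
    ring
  rw [h5, h7, Complex.sub_re, Complex.sub_re, h8, Complex.one_re] at h4
  rw [hGtr] at h4
  linarith

end Fidelity

/-! ### The recovery channel -/

section Recovery

open scoped Kronecker

variable {d ι : Type*} {K : ℕ}

/-- A contraction into `ι × Fin K` followed by discarding `ι` is completed to a channel by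
resetting to a fixed basis state whenever the contraction loses weight. -/
theorem exists_kraus_of_contraction [Fintype d] [DecidableEq d] [Fintype ι] (hK : 1 ≤ K)
    {C : Matrix (ι × Fin K) d ℂ}
    (hC : (1 - Cᴴ * C).PosSemidef) :
    ∃ F : ι ⊕ d → Matrix (Fin K) d ℂ, ∑ k, (F k)ᴴ * F k = 1 ∧
      ∀ b j x, F (Sum.inl b) j x = C (b, j) x := by
  set H := CFC.sqrt (1 - Cᴴ * C) with hH
  have hHH : Hᴴ * H = 1 - Cᴴ * C := by
    rw [(Matrix.nonneg_iff_posSemidef.mp (CFC.sqrt_nonneg (1 - Cᴴ * C))).1.eq]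
    exact CFC.sqrt_mul_sqrt_self _ hC.nonneg
  refine ⟨Sum.elim (fun b => Matrix.of fun j x => C (b, j) x)
    (fun y => Matrix.of fun j x => if j = ⟨0, hK⟩ then H y x else 0), ?_, fun _ _ _ => rfl⟩
  rw [Fintype.sum_sum_type, show (1 : Matrix d d ℂ) = Cᴴ * C + Hᴴ * H by rw [hHH]; abel]
  congr 1
  · ext x y
    simp [Matrix.sum_apply, Matrix.mul_apply, Fintype.sum_prod_type]
  · ext x y
    simp [Matrix.sum_apply, Matrix.mul_apply, apply_ite (starRingEnd ℂ)]

/-- The matrix `V` of the encoding, whose columns are the code words. -/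
def codeMatrix (ψ : Fin K → EuclideanSpace ℂ d) : Matrix d (Fin K) ℂ :=
  Matrix.of fun x i => ψ i x

variable [Fintype d]

theorem braket_eq (ψ : Fin K → EuclideanSpace ℂ d) (M : Matrix d d ℂ) (i j : Fin K) :
    braket (ψ i) M (ψ j) = ((codeMatrix ψ)ᴴ * M * codeMatrix ψ) i j := by
  rw [Matrix.mul_assoc, Matrix.mul_apply]
  rfl

theorem codeMatrix_isometry {ψ : Fin K → EuclideanSpace ℂ d} (hψ : Orthonormal ℂ ψ) :
    (codeMatrix ψ)ᴴ * codeMatrix ψ = 1 := by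
  ext i j
  have := orthonormal_iff_ite.mp hψ i j
  rw [Matrix.one_apply, ← this, EuclideanSpace.inner_eq_star_dotProduct, dotProduct_comm]
  rfl

/-- The matrix whose column `(a, i)` is the faulty code word `Eₐ ψᵢ` if `a ∈ S`, and zero
otherwise. -/
def errorMatrix [DecidableEq ι] (ψ : Fin K → EuclideanSpace ℂ d) (E : ι → Matrix d d ℂ)
    (S : Finset ι) : Matrix d (ι × Fin K) ℂ :=
  Matrix.of fun x p => if p.1 ∈ S then (E p.1 * codeMatrix ψ) x p.2 else 0

theorem errorMatrix_gram_apply [DecidableEq ι] (ψ : Fin K → EuclideanSpace ℂ d)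
    (E : ι → Matrix d d ℂ) (S : Finset ι) (a b : ι) (i j : Fin K) :
    ((errorMatrix ψ E S)ᴴ * errorMatrix ψ E S) (a, i) (b, j) =
      if a ∈ S ∧ b ∈ S then braket (ψ i) ((E a)ᴴ * E b) (ψ j) else 0 := by
  have h : (codeMatrix ψ)ᴴ * ((E a)ᴴ * E b) * codeMatrix ψ =
      (E a * codeMatrix ψ)ᴴ * (E b * codeMatrix ψ) := by
    rw [Matrix.conjTranspose_mul]
    simp only [Matrix.mul_assoc]
  rw [braket_eq, h, Matrix.mul_apply, Matrix.mul_apply]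
  by_cases ha : a ∈ S <;> by_cases hb : b ∈ S <;>
    simp [errorMatrix, ha, hb]

theorem braket_conjTranspose_mul_self_nonneg (ψ : Fin K → EuclideanSpace ℂ d) (A : Matrix d d ℂ)
    (i : Fin K) : 0 ≤ braket (ψ i) (Aᴴ * A) (ψ i) := by
  have h : (codeMatrix ψ)ᴴ * (Aᴴ * A) * codeMatrix ψ =
      (A * codeMatrix ψ)ᴴ * (A * codeMatrix ψ) := by
    rw [Matrix.conjTranspose_mul]
    simp only [Matrix.mul_assoc]
  rw [braket_eq, h]
  exact (Matrix.posSemidef_conjTranspose_mul_self (A * codeMatrix ψ)).diag_nonneg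

theorem omittedWeight_nonneg [Fintype ι] [DecidableEq ι] (ψ : Fin K → EuclideanSpace ℂ d)
    (E : ι → Matrix d d ℂ) (S : Finset ι) : 0 ≤ omittedWeight ψ E S :=
  Finset.sum_nonneg fun i _ => Finset.sum_nonneg fun a _ =>
    (Complex.nonneg_iff.mp (braket_conjTranspose_mul_self_nonneg ψ (E a) i)).1

theorem loss_nonneg (ψ : Fin K → EuclideanSpace ℂ d) (E : ι → Matrix d d ℂ)
    (S : Finset ι) : 0 ≤ loss ψ E S := by
  refine Finset.sum_nonneg fun a _ => Finset.sum_nonneg fun b _ => ?_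
  unfold klViolation
  positivity

theorem sum_kraus_encoded [Fintype ι] [DecidableEq d] {E : ι → Matrix d d ℂ}
    {ψ : Fin K → EuclideanSpace ℂ d}
    (hE : IsKrausFamily E) (hψ : Orthonormal ℂ ψ) :
    ∑ a, (codeMatrix ψ)ᴴ * ((E a)ᴴ * E a) * codeMatrix ψ = 1 := by
  rw [← Matrix.sum_mul, ← Matrix.mul_sum, hE, Matrix.mul_one, codeMatrix_isometry hψ]

variable [DecidableEq ι]

theorem trace_errorMatrix_gram [Fintype ι] [DecidableEq d] {E : ι → Matrix d d ℂ}
    {ψ : Fin K → EuclideanSpace ℂ d}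
    (hE : IsKrausFamily E) (hψ : Orthonormal ℂ ψ) (S : Finset ι) :
    ((errorMatrix ψ E S)ᴴ * errorMatrix ψ E S).trace = ((K - omittedWeight ψ E S : ℝ) : ℂ) := by
  have h1 : ((errorMatrix ψ E S)ᴴ * errorMatrix ψ E S).trace =
      ∑ a ∈ S, ∑ i, braket (ψ i) ((E a)ᴴ * E a) (ψ i) := by
    simp only [Matrix.trace, Matrix.diag_apply, Fintype.sum_prod_type, errorMatrix_gram_apply,
      and_self]
    rw [← Finset.sum_filter_add_sum_filter_not Finset.univ (· ∈ S)]
    rw [Finset.sum_congr rfl (g := fun a => ∑ i, braket (ψ i) ((E a)ᴴ * E a) (ψ i))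
      (fun a ha => by simp [(Finset.mem_filter.mp ha).2]),
      Finset.sum_eq_zero (s := Finset.univ.filter (· ∉ S))
      (fun a ha => by simp [(Finset.mem_filter.mp ha).2])]
    simp
  have h2 : ∑ a, ∑ i, braket (ψ i) ((E a)ᴴ * E a) (ψ i) = K := by
    have := congrArg Matrix.trace (sum_kraus_encoded hE hψ)
    rw [Matrix.trace_sum, Matrix.trace_one, Fintype.card_fin] at this
    rw [← this]
    refine Finset.sum_congr rfl fun a _ => Finset.sum_congr rfl fun i _ => ?_
    rw [braket_eq]
    rfl
  have h3 : ((omittedWeight ψ E S : ℝ) : ℂ) =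
      ∑ a ∈ Sᶜ, ∑ i, braket (ψ i) ((E a)ᴴ * E a) (ψ i) := by
    rw [omittedWeight, Finset.sum_comm]
    push_cast
    refine Finset.sum_congr rfl fun a _ => Finset.sum_congr rfl fun i _ => ?_
    exact Complex.ext rfl
      (Complex.nonneg_iff.mp (braket_conjTranspose_mul_self_nonneg ψ (E a) i)).2
  rw [h1, Complex.ofReal_sub, h3, Complex.ofReal_natCast, ← h2, eq_sub_iff_add_eq,
    Finset.sum_add_sum_compl]

/-- The code average of the Gram matrix of the faulty code words: the state of the
environment in the exactly correctable model. Its trace is below one if errors outside `S` occur. -/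
def averageGram (ψ : Fin K → EuclideanSpace ℂ d) (E : ι → Matrix d d ℂ) (S : Finset ι) :
    Matrix ι ι ℂ :=
  (K : ℂ)⁻¹ • ∑ i, ((errorMatrix ψ E S)ᴴ * errorMatrix ψ E S).submatrix (·, i) (·, i)

theorem averageGram_apply (ψ : Fin K → EuclideanSpace ℂ d) (E : ι → Matrix d d ℂ)
    (S : Finset ι) (a b : ι) :
    averageGram ψ E S a b = if a ∈ S ∧ b ∈ S then codeAverage ψ ((E a)ᴴ * E b) else 0 := by
  rw [averageGram, Matrix.smul_apply, Matrix.sum_apply]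
  simp only [Matrix.submatrix_apply, errorMatrix_gram_apply]
  split_ifs
  · rw [codeAverage, smul_eq_mul]
    ring
  · simp

variable [Fintype ι]

theorem averageGram_posSemidef (ψ : Fin K → EuclideanSpace ℂ d) (E : ι → Matrix d d ℂ)
    (S : Finset ι) : (averageGram ψ E S).PosSemidef := by
  refine (Matrix.posSemidef_sum _ fun i _ =>
    (Matrix.posSemidef_conjTranspose_mul_self _).submatrix _).smul ?_
  rw [← Complex.ofReal_natCast, ← Complex.ofReal_inv]
  exact Complex.zero_le_real.mpr (by positivity)

theorem trace_averageGram (ψ : Fin K → EuclideanSpace ℂ d) (E : ι → Matrix d d ℂ)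
    (S : Finset ι) : (averageGram ψ E S).trace =
      (K : ℂ)⁻¹ * ((errorMatrix ψ E S)ᴴ * errorMatrix ψ E S).trace := by
  rw [averageGram, Matrix.trace_smul, Matrix.trace_sum, smul_eq_mul]
  congr 1
  simp only [Matrix.trace, Matrix.diag_apply, Matrix.submatrix_apply, Fintype.sum_prod_type]
  exact Finset.sum_comm

/-- The loss function is half of the entrywise `L¹` distance between the Gram matrix of the faulty
code words and that of the exactly correctable model. -/
theorem sum_norm_gram_sub (ψ : Fin K → EuclideanSpace ℂ d) (E : ι → Matrix d d ℂ)
    (S : Finset ι) :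
    ∑ p, ∑ q, ‖((errorMatrix ψ E S)ᴴ * errorMatrix ψ E S -
      averageGram ψ E S ⊗ₖ (1 : Matrix (Fin K) (Fin K) ℂ)) p q‖ = 2 * loss ψ E S := by
  set D : ι → ι → Fin K → Fin K → ℝ := fun a b i j =>
    ‖braket (ψ i) ((E a)ᴴ * E b) (ψ j) - if i = j then codeAverage ψ ((E a)ᴴ * E b) else 0‖ with hD
  have hentry : ∀ a i b j, ‖((errorMatrix ψ E S)ᴴ * errorMatrix ψ E S -
      averageGram ψ E S ⊗ₖ (1 : Matrix (Fin K) (Fin K) ℂ)) (a, i) (b, j)‖ =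
      if a ∈ S then (if b ∈ S then D a b i j else 0) else 0 := fun a i b j => by
    rw [Matrix.sub_apply, errorMatrix_gram_apply, Matrix.kronecker_apply, averageGram_apply,
      Matrix.one_apply]
    by_cases ha : a ∈ S <;> by_cases hb : b ∈ S <;> simp [ha, hb, hD]
  -- Pairs `i > j` for `(a, b)` are pairs `i < j` for `(b, a)`, whence the factor two.
  have hsymm : ∀ a b i j, D a b i j = D b a j i := fun a b i j => by
    have h1 : ∀ i j, braket (ψ i) ((E a)ᴴ * E b) (ψ j) =
        star (braket (ψ j) ((E b)ᴴ * E a) (ψ i)) := fun i j => by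
      rw [braket_eq, braket_eq, ← Matrix.conjTranspose_apply]
      simp only [Matrix.conjTranspose_mul, Matrix.conjTranspose_conjTranspose, Matrix.mul_assoc]
    have h2 : codeAverage ψ ((E a)ᴴ * E b) = star (codeAverage ψ ((E b)ᴴ * E a)) := by
      simp [codeAverage, h1]
    simp only [hD]
    rw [← norm_star, star_sub, h1, star_star, h2]
    by_cases hij : i = j
    · simp [hij]
    · simp [hij, Ne.symm hij]
  have hsplit : ∀ a b, ∑ i, ∑ j, D a b i j =
      (∑ i, ∑ j ∈ Finset.Ioi i, D a b i j) + (∑ i, ∑ j ∈ Finset.Ioi i, D b a i j) +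
        ∑ i, D a b i i := fun a b => by
    have h := Finset.sum_sum_Ioi_add_eq_sum_sum_off_diag (fun i j => D a b j i)
    simp only [Finset.sum_add_distrib] at h
    simp only [fun i j => hsymm b a i j]
    rw [h, ← Finset.sum_add_distrib]
    exact Finset.sum_congr rfl fun i _ => by
      rw [Fintype.sum_eq_add_sum_compl i, add_comm]
  have hviol : ∀ a b, klViolation ψ ((E a)ᴴ * E b) =
      (∑ i, ∑ j ∈ Finset.Ioi i, D a b i j) + (1 / 2) * ∑ i, D a b i i := fun a b => by
    rw [klViolation, Finset.mul_sum]
    congr 1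
    · refine Finset.sum_congr rfl fun i _ => Finset.sum_congr rfl fun j hj => ?_
      simp [hD, (Finset.mem_Ioi.mp hj).ne]
    · simp [hD]
  have hleft : ∑ p, ∑ q, ‖((errorMatrix ψ E S)ᴴ * errorMatrix ψ E S -
      averageGram ψ E S ⊗ₖ (1 : Matrix (Fin K) (Fin K) ℂ)) p q‖ =
      ∑ a ∈ S, ∑ b ∈ S, ∑ i, ∑ j, D a b i j := by
    simp only [Fintype.sum_prod_type, hentry]
    rw [← Finset.sum_subset (Finset.subset_univ S)]
    · refine Finset.sum_congr rfl fun a ha => ?_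
      rw [Finset.sum_comm, ← Finset.sum_subset (Finset.subset_univ S)]
      · exact Finset.sum_congr rfl fun b hb => by simp [ha, hb]
      · intro b _ hb
        simp [hb]
    · intro a _ ha
      simp [ha]
  rw [hleft, loss]
  simp only [hsplit, hviol, Finset.sum_add_distrib, ← Finset.mul_sum]
  rw [Finset.sum_comm (s := S) (t := S) (f := fun a b => ∑ i, ∑ j ∈ Finset.Ioi i, D b a i j)]
  ring

variable [DecidableEq d]

/-- The Powers–Størmer inequality bounds the overlap of the square roots of the Gram matrix and of
its exactly correctable model from below. -/
theorem le_re_trace_sqrt_mul_sqrt (hK : 1 ≤ K) {E : ι → Matrix d d ℂ}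
    {ψ : Fin K → EuclideanSpace ℂ d}
    (hE : IsKrausFamily E) (hψ : Orthonormal ℂ ψ) (S : Finset ι) :
    K - omittedWeight ψ E S - loss ψ E S ≤
      ((CFC.sqrt (averageGram ψ E S) ⊗ₖ (1 : Matrix (Fin K) (Fin K) ℂ)) *
        CFC.sqrt ((errorMatrix ψ E S)ᴴ * errorMatrix ψ E S)).trace.re := by
  set M := (errorMatrix ψ E S)ᴴ * errorMatrix ψ E S with hM
  set P := CFC.sqrt M with hP
  set Q := CFC.sqrt (averageGram ψ E S) ⊗ₖ (1 : Matrix (Fin K) (Fin K) ℂ) with hQ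
  have hPpos : P.PosSemidef := Matrix.nonneg_iff_posSemidef.mp (CFC.sqrt_nonneg M)
  have hQpos : Q.PosSemidef :=
    (Matrix.nonneg_iff_posSemidef.mp (CFC.sqrt_nonneg (averageGram ψ E S))).kronecker
      Matrix.PosSemidef.one
  have hPP : P * P = M :=
    CFC.sqrt_mul_sqrt_self _ (Matrix.posSemidef_conjTranspose_mul_self (errorMatrix ψ E S)).nonneg
  have hQQ : Q * Q = averageGram ψ E S ⊗ₖ (1 : Matrix (Fin K) (Fin K) ℂ) := by
    rw [hQ, ← Matrix.mul_kronecker_mul, Matrix.mul_one,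
      CFC.sqrt_mul_sqrt_self _ (averageGram_posSemidef ψ E S).nonneg]
  have h := sum_norm_sq_sub_le hPpos hQpos
  rw [hPP, hQQ, sum_norm_gram_sub] at h
  have h1 := congrArg Complex.re (trace_mul_conjTranspose (P - Q))
  have hK0 : (K : ℂ) ≠ 0 := by exact_mod_cast (by omega : K ≠ 0)
  have htr : (Q * Q).trace = M.trace := by
    rw [hQQ, Matrix.trace_kronecker, trace_averageGram, Matrix.trace_one, Fintype.card_fin,
      hM]
    field_simp
  have h2 : ((P - Q) * (P - Q)ᴴ).trace = 2 * M.trace - 2 * (Q * P).trace := by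
    rw [(hPpos.1.sub hQpos.1).eq, Matrix.sub_mul, Matrix.mul_sub, Matrix.mul_sub,
      Matrix.trace_sub, Matrix.trace_sub, Matrix.trace_sub, htr, hPP, Matrix.trace_mul_comm P Q]
    ring
  rw [h2, hM, trace_errorMatrix_gram hE hψ, Complex.ofReal_re] at h1
  simp only [Complex.sub_re, Complex.mul_re, Complex.re_ofNat, Complex.im_ofNat, zero_mul,
    sub_zero, Complex.ofReal_re] at h1
  linarith

/-- A single recovery channel restores every entangled logical state up to the infidelity given by
the loss and the weight of the omitted errors. -/
theorem exists_recovery (hK : 1 ≤ K) {E : ι → Matrix d d ℂ} {ψ : Fin K → EuclideanSpace ℂ d}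
    (hE : IsKrausFamily E) (hψ : Orthonormal ℂ ψ) (S : Finset ι) :
    ∃ R : Channel d (Fin K), ∀ (m : ℕ) (ρ : DensityMatrix (Fin K × Fin m)),
      1 - (loss ψ E S + omittedWeight ψ E S) ≤
        fidelity (amplify (Fin m) (R.toMap ∘ₗ krausMap E ∘ₗ encode ψ) ρ.1) ρ.1 := by
  set W := errorMatrix ψ E S with hW
  set P := CFC.sqrt (Wᴴ * W) with hP
  have hPpos : P.PosSemidef := Matrix.nonneg_iff_posSemidef.mp (CFC.sqrt_nonneg _)
  obtain ⟨C, hCW, hC⟩ := exists_contraction_mul_eq W hPpos.1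
    (CFC.sqrt_mul_sqrt_self _ (Matrix.posSemidef_conjTranspose_mul_self W).nonneg)
  obtain ⟨F, hF, hFC⟩ := exists_kraus_of_contraction hK hC
  set Λ := CFC.sqrt (averageGram ψ E S) with hΛ
  have hΛpos : Λ.PosSemidef := Matrix.nonneg_iff_posSemidef.mp (CFC.sqrt_nonneg _)
  -- The Kraus operators of noise and recovery on the logical system. Those with `k = inl b` and
  -- `a ∈ S` are the blocks `(b, a)` of `C W = √(Wᴴ W)`.
  let A : (ι ⊕ d) × ι → Matrix (Fin K) (Fin K) ℂ := fun p => F p.1 * (E p.2 * codeMatrix ψ)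
  have hA : ∑ p, (A p)ᴴ * A p = 1 := by
    rw [Fintype.sum_prod_type, Finset.sum_comm, ← sum_kraus_encoded hE hψ]
    refine Finset.sum_congr rfl fun a _ => ?_
    calc ∑ k, (A (k, a))ᴴ * A (k, a) =
        ∑ k, (E a * codeMatrix ψ)ᴴ * ((F k)ᴴ * F k) * (E a * codeMatrix ψ) :=
          Finset.sum_congr rfl fun k _ => by
            simp only [A, Matrix.conjTranspose_mul, Matrix.mul_assoc]
      _ = _ := by
          rw [← Matrix.sum_mul, ← Matrix.mul_sum, hF, Matrix.conjTranspose_mul]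
          simp only [Matrix.mul_one, Matrix.mul_assoc]
  have hmap : (krausChannel F hF).toMap ∘ₗ krausMap E ∘ₗ encode ψ = ∑ p, conjMap (A p) := by
    ext1 M
    rw [sum_conjMap_apply, Fintype.sum_prod_type]
    simp only [krausChannel, krausMap, encode, LinearMap.comp_apply, sum_conjMap_apply]
    refine Finset.sum_congr rfl fun k _ => ?_
    rw [Matrix.mul_sum, Matrix.sum_mul]
    refine Finset.sum_congr rfl fun a _ => ?_
    simp only [A, conjMap, LinearMap.coe_mk, AddHom.coe_mk, Matrix.conjTranspose_mul,
      Matrix.mul_assoc]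
    rfl
  -- In the exactly correctable model these blocks are the scalars `Λ b a`, which serve as the
  -- coefficients; all other Kraus operators get the coefficient zero.
  let s : (ι ⊕ d) × ι → ℂ := fun p => Sum.elim (fun b => if p.2 ∈ S then Λ b p.2 else 0) 0 p.1
  have hs : ∑ p, ‖s p‖ ^ 2 ≤ 1 := by
    have h1 : ∑ p, ‖s p‖ ^ 2 ≤ ∑ b, ∑ a, ‖Λ b a‖ ^ 2 := by
      rw [Fintype.sum_prod_type, Fintype.sum_sum_type]
      simp only [s, Sum.elim_inl, Sum.elim_inr, Pi.zero_apply, norm_zero]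
      simp only [ne_eq, OfNat.ofNat_ne_zero, not_false_eq_true, zero_pow, Finset.sum_const_zero,
        add_zero]
      refine Finset.sum_le_sum fun b _ => Finset.sum_le_sum fun a _ => ?_
      split_ifs
      · rfl
      · simp
    refine h1.trans ?_
    have h2 := trace_mul_conjTranspose Λ
    rw [hΛpos.1.eq, hΛ, CFC.sqrt_mul_sqrt_self _ (averageGram_posSemidef ψ E S).nonneg,
      trace_averageGram, trace_errorMatrix_gram hE hψ, ← hΛ, ← Complex.ofReal_natCast,
      ← Complex.ofReal_inv, ← Complex.ofReal_mul] at h2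
    rw [← Complex.ofReal_injective h2]
    have hK0 : (0 : ℝ) < K := by exact_mod_cast hK
    rw [inv_mul_le_iff₀ hK0]
    linarith [omittedWeight_nonneg ψ E S]
  have hsum : ∑ p, star (s p) * (A p).trace =
      ((Λ ⊗ₖ (1 : Matrix (Fin K) (Fin K) ℂ)) * P).trace := by
    rw [Fintype.sum_prod_type, Fintype.sum_sum_type]
    simp only [s, Sum.elim_inl, Sum.elim_inr, Pi.zero_apply, star_zero, zero_mul,
      Finset.sum_const_zero, add_zero]
    have h1 : ∀ b a, star (if a ∈ S then Λ b a else 0) * (A (Sum.inl b, a)).trace =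
        Λ a b * ∑ i, P (b, i) (a, i) := fun b a => by
      rw [← hCW]
      by_cases ha : a ∈ S
      · rw [if_pos ha, hΛpos.1.apply]
        congr 1
        refine Finset.sum_congr rfl fun i _ => ?_
        simp only [A, Matrix.diag_apply, Matrix.mul_apply (M := F _), Matrix.mul_apply (M := C),
          hFC, hW, errorMatrix, Matrix.of_apply, ha, if_true]
      · rw [if_neg ha, star_zero, zero_mul]
        simp [Matrix.mul_apply, hW, errorMatrix, ha]
    simp only [h1]
    rw [Finset.sum_comm]
    simp only [Matrix.trace, Matrix.diag_apply, Matrix.mul_apply, Fintype.sum_prod_type,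
      Matrix.kronecker_apply, Matrix.one_apply, mul_ite, mul_one, mul_zero, ite_mul, zero_mul,
      Finset.sum_ite_eq, Finset.mem_univ, if_true, Finset.mul_sum]
    exact Finset.sum_congr rfl fun a _ => Finset.sum_comm
  refine ⟨krausChannel F hF, fun m ρ => ?_⟩
  rw [hmap]
  refine le_trans ?_ (le_fidelity_amplify A hA s hs ρ.2.1 ρ.2.2)
  have := le_re_trace_sqrt_mul_sqrt hK hE hψ S
  rw [hsum, Fintype.card_fin]
  linarith

end Recovery

/-! ### Comparison of the two fidelities -/

section Comparison

theorem Channel.map_posSemidef {a b : Type*} [Fintype a] [Fintype b] (R : Channel a b)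
    {M : Matrix a a ℂ} (hM : M.PosSemidef) : (R.toMap M).PosSemidef :=
  (R.completelyPositive 1 (M.submatrix Prod.fst Prod.fst) (hM.submatrix _)).submatrix (·, 0)

theorem sqrt_submatrix_equiv {m n : Type*} [Fintype m] [DecidableEq m] [Fintype n] [DecidableEq n]
    (e : m ≃ n) {M : Matrix n n ℂ} (hM : M.PosSemidef) :
    CFC.sqrt (M.submatrix e e) = (CFC.sqrt M).submatrix e e := by
  have h : ((CFC.sqrt M).submatrix e e).PosSemidef :=
    (Matrix.nonneg_iff_posSemidef.mp (CFC.sqrt_nonneg M)).submatrix e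
  refine CFC.sqrt_unique ?_ h.nonneg
  rw [Matrix.submatrix_mul_equiv, CFC.sqrt_mul_sqrt_self M hM.nonneg]

theorem fidelity_submatrix_equiv {m n : Type*} [Fintype m] [DecidableEq m] [Fintype n]
    [DecidableEq n] (e : m ≃ n) {ρ σ : Matrix n n ℂ} (hρ : ρ.PosSemidef) (hσ : σ.PosSemidef) :
    fidelity (ρ.submatrix e e) (σ.submatrix e e) = fidelity ρ σ := by
  have h : (CFC.sqrt ρ * σ * CFC.sqrt ρ).PosSemidef := by
    have := hσ.mul_mul_conjTranspose_same (CFC.sqrt ρ)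
    rwa [(Matrix.nonneg_iff_posSemidef.mp (CFC.sqrt_nonneg ρ)).1.eq] at this
  rw [fidelity, fidelity, sqrt_submatrix_equiv e hρ, Matrix.submatrix_mul_equiv,
    Matrix.submatrix_mul_equiv, sqrt_submatrix_equiv e h]
  congr 1
  exact Equiv.sum_comp e fun i => CFC.sqrt (CFC.sqrt ρ * σ * CFC.sqrt ρ) i i

theorem amplify_submatrix_prodUnique {a b r : Type*} [Unique r]
    (Φ : Matrix a a ℂ →ₗ[ℂ] Matrix b b ℂ) (M : Matrix a a ℂ) :
    amplify r Φ (M.submatrix (Equiv.prodUnique a r) (Equiv.prodUnique a r)) =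
      (Φ M).submatrix (Equiv.prodUnique b r) (Equiv.prodUnique b r) :=
  rfl

theorem single_posSemidef {n : Type*} [Fintype n] [DecidableEq n] (i : n) {x : ℝ} (hx : 0 ≤ x) :
    (Matrix.single i i (x : ℂ)).PosSemidef := by
  rw [← Matrix.diagonal_single]
  refine Matrix.PosSemidef.diagonal ?_
  rw [Pi.single_nonneg]
  exact Complex.zero_le_real.mpr hx

/-- The fidelity of a state with a basis state is at most one. -/
theorem fidelity_single_le_one {n : Type*} [Fintype n] [DecidableEq n] (i : n) {σ : Matrix n n ℂ}
    (hσ : σ.PosSemidef) (hσ1 : σ.trace = 1) : fidelity σ (Matrix.single i i 1) ≤ 1 := by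
  have hsq : ∀ x : ℝ, 0 ≤ x → CFC.sqrt (Matrix.single i i ((x ^ 2 : ℝ) : ℂ)) =
      Matrix.single i i (x : ℂ) := fun x hx => by
    refine CFC.sqrt_unique ?_ (single_posSemidef i hx).nonneg
    rw [Matrix.single_mul_single_same]
    push_cast
    rw [sq]
  have h1 : (Matrix.single i i (1 : ℂ)).PosSemidef := by
    simpa using single_posSemidef i zero_le_one
  have hs1 : CFC.sqrt (Matrix.single i i (1 : ℂ)) = Matrix.single i i 1 := by
    simpa using hsq 1 zero_le_one
  have hii := hσ.diag_nonneg (i := i)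
  obtain ⟨hre, him⟩ := Complex.nonneg_iff.mp hii
  have hle : (σ i i).re ≤ 1 := by
    have h2 : (σ.trace).re = 1 := by rw [hσ1, Complex.one_re]
    rw [← h2, Matrix.trace, Complex.re_sum]
    exact Finset.single_le_sum (f := fun j => (σ.diag j).re)
      (fun j _ => (Complex.nonneg_iff.mp (hσ.diag_nonneg (i := j))).1) (Finset.mem_univ i)
  have hx : σ i i = ((√(σ i i).re ^ 2 : ℝ) : ℂ) := by
    rw [Real.sq_sqrt hre]
    exact Complex.ext rfl him.symm
  rw [fidelity_comm hσ h1, fidelity, hs1, Matrix.single_mul_mul_single, one_mul, mul_one, hx,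
    hsq _ (Real.sqrt_nonneg _), Matrix.trace_single_eq_same, Complex.ofReal_re]
  exact Real.sqrt_le_one.mpr hle

variable {d ι : Type*} [Fintype d] [Fintype ι] {K : ℕ}
  {E : ι → Matrix d d ℂ} {ψ : Fin K → EuclideanSpace ℂ d}

theorem recovered_posSemidef (R : Channel d (Fin K)) (E : ι → Matrix d d ℂ)
    (ψ : Fin K → EuclideanSpace ℂ d) {ρ : Matrix (Fin K) (Fin K) ℂ}
    (hρ : ρ.PosSemidef) : ((R.toMap ∘ₗ krausMap E ∘ₗ encode ψ) ρ).PosSemidef := by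
  refine R.map_posSemidef ?_
  rw [LinearMap.comp_apply, krausMap, sum_conjMap_apply]
  exact Matrix.posSemidef_sum _ fun a _ =>
    (hρ.mul_mul_conjTranspose_same _).mul_mul_conjTranspose_same _

theorem omittedWeight_univ [DecidableEq ι] (ψ : Fin K → EuclideanSpace ℂ d) (E : ι → Matrix d d ℂ) :
    omittedWeight ψ E Finset.univ = 0 := by
  simp [omittedWeight]

theorem nonempty_densityMatrix {n : Type*} [Fintype n] [Nonempty n] :
    Nonempty (DensityMatrix n) := by
  classical
  obtain ⟨i⟩ := ‹Nonempty n›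
  exact ⟨⟨Matrix.single i i 1, by simpa using single_posSemidef i zero_le_one,
    Matrix.trace_single_eq_same i 1⟩⟩

theorem bddBelow_fidelity {α n : Type*} [Fintype n] [DecidableEq n] (f g : α → Matrix n n ℂ) :
    BddBelow (Set.range fun x => fidelity (f x) (g x)) :=
  ⟨0, by rintro _ ⟨x, rfl⟩; exact fidelity_nonneg _ _⟩

/-- States without a reference system are those with a one-dimensional reference system. -/
theorem iInf_cb_le_iInf (hK : 1 ≤ K) (E : ι → Matrix d d ℂ) (ψ : Fin K → EuclideanSpace ℂ d)
    (R : Channel d (Fin K)) :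
    ⨅ p : Σ m : ℕ, DensityMatrix (Fin K × Fin m),
      fidelity (amplify (Fin p.1) (R.toMap ∘ₗ krausMap E ∘ₗ encode ψ) p.2.1) p.2.1 ≤
    ⨅ ρ : DensityMatrix (Fin K), fidelity ((R.toMap ∘ₗ krausMap E ∘ₗ encode ψ) ρ.1) ρ.1 := by
  have : Nonempty (Fin K) := ⟨⟨0, hK⟩⟩
  have : Nonempty (DensityMatrix (Fin K)) := nonempty_densityMatrix
  refine le_ciInf fun ρ => ?_
  let e : Fin K × Fin 1 ≃ Fin K := Equiv.prodUnique (Fin K) (Fin 1)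
  let ρ' : DensityMatrix (Fin K × Fin 1) := ⟨ρ.1.submatrix e e, ρ.2.1.submatrix e,
    (Equiv.sum_comp e fun i => ρ.1 i i).trans ρ.2.2⟩
  refine ciInf_le_of_le ⟨0, ?_⟩ ⟨1, ρ'⟩ (le_of_eq ?_)
  · rintro _ ⟨p, rfl⟩
    exact fidelity_nonneg _ _
  · change fidelity (amplify (Fin 1) _ (ρ.1.submatrix e e)) (ρ.1.submatrix e e) = _
    rw [amplify_submatrix_prodUnique]
    exact fidelity_submatrix_equiv e (recovered_posSemidef R E ψ ρ.2.1) ρ.2.1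

variable [DecidableEq d]

theorem trace_recovered (R : Channel d (Fin K)) (hE : IsKrausFamily E) (hψ : Orthonormal ℂ ψ)
    (ρ : Matrix (Fin K) (Fin K) ℂ) :
    ((R.toMap ∘ₗ krausMap E ∘ₗ encode ψ) ρ).trace = ρ.trace := by
  have h1 : (encode ψ ρ).trace = ρ.trace := by
    change (codeMatrix ψ * ρ * (codeMatrix ψ)ᴴ).trace = _
    rw [Matrix.trace_mul_cycle, codeMatrix_isometry hψ, Matrix.one_mul]
  rw [LinearMap.comp_apply, R.tracePreserving, LinearMap.comp_apply,
    ← h1, ← (krausChannel E hE).tracePreserving (encode ψ ρ)]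
  rfl

theorem iInf_fidelity_le_one (hK : 1 ≤ K) (hE : IsKrausFamily E) (hψ : Orthonormal ℂ ψ)
    (R : Channel d (Fin K)) :
    ⨅ ρ : DensityMatrix (Fin K), fidelity ((R.toMap ∘ₗ krausMap E ∘ₗ encode ψ) ρ.1) ρ.1 ≤ 1 := by
  let ρ₀ : DensityMatrix (Fin K) := ⟨Matrix.single ⟨0, hK⟩ ⟨0, hK⟩ 1,
    by simpa using single_posSemidef _ zero_le_one, Matrix.trace_single_eq_same _ 1⟩
  refine ciInf_le_of_le (bddBelow_fidelity _ _) ρ₀ (fidelity_single_le_one _ ?_ ?_)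
  · exact recovered_posSemidef R E ψ ρ₀.2.1
  · rw [trace_recovered R hE hψ, ρ₀.2.2]

theorem bddAbove_iInf_fidelity (hK : 1 ≤ K) (hE : IsKrausFamily E) (hψ : Orthonormal ℂ ψ) :
    BddAbove (Set.range fun R : Channel d (Fin K) => ⨅ ρ : DensityMatrix (Fin K),
      fidelity ((R.toMap ∘ₗ krausMap E ∘ₗ encode ψ) ρ.1) ρ.1) :=
  ⟨1, by rintro _ ⟨R, rfl⟩; exact iInf_fidelity_le_one hK hE hψ R⟩

theorem cbFidelity_le_worstCaseFidelity (hK : 1 ≤ K) (hE : IsKrausFamily E)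
    (hψ : Orthonormal ℂ ψ) :
    cbFidelity (encode ψ) (krausMap E) ≤ worstCaseFidelity (encode ψ) (krausMap E) :=
  ciSup_mono (bddAbove_iInf_fidelity hK hE hψ) (iInf_cb_le_iInf hK E ψ)

variable [DecidableEq ι]

theorem worstCaseFidelity_le_one (hK : 1 ≤ K) (hE : IsKrausFamily E) (hψ : Orthonormal ℂ ψ) :
    worstCaseFidelity (encode ψ) (krausMap E) ≤ 1 := by
  have : Nonempty (Channel d (Fin K)) := ⟨(exists_recovery hK hE hψ ∅).choose⟩
  exact ciSup_le (iInf_fidelity_le_one hK hE hψ)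

/-- The loss and the weight of the omitted errors bound the infidelity linearly, with constants
independent of the dimension of the code. -/
theorem one_sub_le_cbFidelity (hK : 1 ≤ K) (hE : IsKrausFamily E) (hψ : Orthonormal ℂ ψ)
    (S : Finset ι) :
    1 - (loss ψ E S + omittedWeight ψ E S) ≤ cbFidelity (encode ψ) (krausMap E) := by
  obtain ⟨R, hR⟩ := exists_recovery hK hE hψ S
  have : Nonempty (Fin K) := ⟨⟨0, hK⟩⟩
  have : Nonempty (Σ m : ℕ, DensityMatrix (Fin K × Fin m)) :=
    ⟨⟨1, nonempty_densityMatrix.some⟩⟩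
  refine le_ciSup_of_le ((bddAbove_iInf_fidelity hK hE hψ).range_mono _
    (iInf_cb_le_iInf hK E ψ)) R (le_ciInf fun p => hR p.1 p.2)

theorem isBigO_one_sub_fidelity (hK : 1 ≤ K) {l : Filter ℝ} {g : ℝ → ℝ}
    {E : ℝ → ι → Matrix d d ℂ} {ψ : ℝ → Fin K → EuclideanSpace ℂ d} {S : Finset ι}
    (h : ∀ᶠ γ in l, IsKrausFamily (E γ) ∧ Orthonormal ℂ (ψ γ))
    (hw : (fun γ => omittedWeight (ψ γ) (E γ) S) =O[l] g)
    (hL : (fun γ => loss (ψ γ) (E γ) S) =O[l] g) :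
    (fun γ => 1 - cbFidelity (encode (ψ γ)) (krausMap (E γ))) =O[l] g ∧
      (fun γ => 1 - worstCaseFidelity (encode (ψ γ)) (krausMap (E γ))) =O[l] g := by
  constructor <;> refine IsBigO.trans (IsBigO.of_bound 1 ?_) (hL.add hw) <;>
  · filter_upwards [h] with γ ⟨hE, hψ⟩
    have h1 := one_sub_le_cbFidelity hK hE hψ S
    have h2 := cbFidelity_le_worstCaseFidelity hK hE hψ
    have h3 := worstCaseFidelity_le_one hK hE hψ
    rw [one_mul, Real.norm_of_nonneg (by linarith), Real.norm_of_nonneg (by linarith)]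
    linarith

end Comparison

end AQEC

end

theorem mainTheorem7 {d ι : Type*} [Fintype d] [DecidableEq d] [Fintype ι] [DecidableEq ι]
    (K : ℕ) (hK : 1 ≤ K) :
    -- the bound for a single code and a single noise channel
    (∀ (E : ι → Matrix d d ℂ) (ψ : Fin K → EuclideanSpace ℂ d),
      AQEC.IsKrausFamily E → Orthonormal ℂ ψ →
        √(1 - AQEC.cbFidelity (AQEC.encode ψ) (AQEC.krausMap E)) ≤
            K * √(2 * AQEC.loss ψ E Finset.univ) ∧
        1 - 2 * (K : ℝ) ^ 2 * AQEC.loss ψ E Finset.univ ≤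
            AQEC.cbFidelity (AQEC.encode ψ) (AQEC.krausMap E) ∧
        AQEC.cbFidelity (AQEC.encode ψ) (AQEC.krausMap E) ≤
            AQEC.worstCaseFidelity (AQEC.encode ψ) (AQEC.krausMap E) ∧
        AQEC.worstCaseFidelity (AQEC.encode ψ) (AQEC.krausMap E) ≤ 1) ∧
    -- the scaling in the noise strength, for families of codes and noise channels
    (∀ (E : ℝ → ι → Matrix d d ℂ) (ψ : ℝ → Fin K → EuclideanSpace ℂ d) (t : ℕ),
      (∀ᶠ γ in 𝓝[>] (0 : ℝ), AQEC.IsKrausFamily (E γ) ∧ Orthonormal ℂ (ψ γ)) →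
      (fun γ => AQEC.loss (ψ γ) (E γ) Finset.univ) =O[𝓝[>] 0] (fun γ : ℝ => γ ^ (t + 1)) →
        (fun γ => 1 - AQEC.cbFidelity (AQEC.encode (ψ γ)) (AQEC.krausMap (E γ)))
            =O[𝓝[>] 0] (fun γ : ℝ => γ ^ (t + 1)) ∧
        (fun γ => 1 - AQEC.worstCaseFidelity (AQEC.encode (ψ γ)) (AQEC.krausMap (E γ)))
            =O[𝓝[>] 0] (fun γ : ℝ => γ ^ (t + 1))) ∧
    -- the same scaling when the loss only sees a set of errors outside of which the noise has
    -- weight of order `γ ^ (t + 1)`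
    (∀ (E : ℝ → ι → Matrix d d ℂ) (ψ : ℝ → Fin K → EuclideanSpace ℂ d) (S : Finset ι) (t : ℕ),
      (∀ᶠ γ in 𝓝[>] (0 : ℝ), AQEC.IsKrausFamily (E γ) ∧ Orthonormal ℂ (ψ γ)) →
      (fun γ => AQEC.omittedWeight (ψ γ) (E γ) S) =O[𝓝[>] 0] (fun γ : ℝ => γ ^ (t + 1)) →
      (fun γ => AQEC.loss (ψ γ) (E γ) S) =O[𝓝[>] 0] (fun γ : ℝ => γ ^ (t + 1)) →
        (fun γ => 1 - AQEC.cbFidelity (AQEC.encode (ψ γ)) (AQEC.krausMap (E γ)))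
            =O[𝓝[>] 0] (fun γ : ℝ => γ ^ (t + 1)) ∧
        (fun γ => 1 - AQEC.worstCaseFidelity (AQEC.encode (ψ γ)) (AQEC.krausMap (E γ)))
            =O[𝓝[>] 0] (fun γ : ℝ => γ ^ (t + 1))) := by
  refine ⟨fun E ψ hE hψ => ?_, fun E ψ t h hL => ?_, fun E ψ S t h hw hL =>
    AQEC.isBigO_one_sub_fidelity hK h hw hL⟩
  · -- The bound `1 - F ≤ L` is stronger than required, as `1 ≤ K`.
    have h1 := AQEC.one_sub_le_cbFidelity hK hE hψ Finset.univ
    rw [AQEC.omittedWeight_univ, add_zero] at h1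
    have h0 := AQEC.loss_nonneg ψ E Finset.univ
    have hK1 : (1 : ℝ) ≤ K := by exact_mod_cast hK
    have hK2 : AQEC.loss ψ E Finset.univ ≤ 2 * (K : ℝ) ^ 2 * AQEC.loss ψ E Finset.univ :=
      le_mul_of_one_le_left h0 (by nlinarith)
    refine ⟨?_, by linarith, AQEC.cbFidelity_le_worstCaseFidelity hK hE hψ,
      AQEC.worstCaseFidelity_le_one hK hE hψ⟩
    refine Real.sqrt_le_iff.mpr ⟨by positivity, ?_⟩
    rw [mul_pow, Real.sq_sqrt (by positivity)]
    linarith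
  · refine AQEC.isBigO_one_sub_fidelity hK h ?_ hL
    simp only [AQEC.omittedWeight_univ]
    exact isBigO_zero _ _
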